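/- **Model.** The adversarial CONGEST model on an $n$-node simple graph $G=(V,E)$: nodes have unique $O(\log n)$-bit identifiers and communicate in synchronous rounds; in each round each node may send a (possibly different) $O(\log n)$-bit message to each neighbour. Local computation is free, and each node has private independent uniform random bits. Initially a node knows only its own identifier, the identifiers of its neighbours, a polynomial estimate $N$ of $n$ (that is, $n\le N^{a}$ and $N\le n^{a}$ for a constant $a$), the bound $t$, and a linear estimate $\psi$ of the expansion parameter $\phi$ (that is, $\phi\le b\psi$ and $\psi\le b\phi$ for a constant $b$). A computationally unbounded adversary controls a fixed set $F\subseteq E$ of at most $t$ edges, unknown to the nodes. It knows the graph, the protocol, the inputs and all random bits of the nodes, and in each round, depending on all messages sent in the network so far, it decides which $O(\log n)$-bit message (if any) is delivered on each edge of $F$, separately in each direction. In the broadcast task a source node $s$ holds an $O(\log n)$-bit message $m_0$, and every node has to output $m_0$. **Expanders.** For $S\subseteq V$ let $\delta_G(S)$ be the number of edges between $S$ and $V\setminus S$, and $\mathrm{vol}_G(S)$ the number of edges incident to $S$. $G$ is a $\phi$-expander if $\delta_G(S)\ge\phi\cdot\min\{\mathrm{vol}_G(S),\mathrm{vol}_G(V\setminus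 S)\}$ for every $S\subseteq V$ such that $S$ and $V\setminus S$ have positive volume. **Theorem 3.** For all constants $a\ge 1$ (governing the estimate of $n$ and the lengths of identifiers and of $m_0$), $b\ge 1$ and $c\ge 0$ there are constants $C,K>0$, a message-size bound of $O(\log n)$ bits and a randomized algorithm, which depends on $N$, $t$ and $\psi$ but not on the graph, such that the following holds for all $n\ge 2$, $t\ge 1$ and $\phi>0$. On every $n$-node $\phi$-expander $G$ with minimum degree at least $C\,t^2\log n/\phi$, the algorithm runs for at most $K\,t\log^2 n/\phi$ rounds and, for every assignment of identifiers, every source $s$, every message $m_0$, every set $F\subseteq E$ with $|F|\le t$ and every adversary strategy controlling $F$, with probability at least $1-n^{-c}$ all nodes output $m_0$. -/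

import Mathlib

namespace AdvCongest

/-! ### Expander graphs -/

section Expander

variable {V : Type*} [Fintype V] [DecidableEq V] (G : SimpleGraph V) [DecidableRel G.Adj]

/-- The number of edges of `G` with one endpoint in `S` and the other one outside `S`. -/
def cutSize (S : Finset V) : ℕ :=
  (G.edgeFinset.filter fun e => (∃ u ∈ S, u ∈ e) ∧ ∃ v ∈ Sᶜ, v ∈ e).card

/-- The volume of `S`: the number of edges of `G` incident to `S`. -/
def vol (S : Finset V) : ℕ :=
  (G.edgeFinset.filter fun e => ∃ v ∈ S, v ∈ e).card

/-- The conductance of a cut (meaningful when both sides have positive volume). -/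
noncomputable def conductance (S : Finset V) : ℝ :=
  (cutSize G S : ℝ) / (min (vol G S) (vol G Sᶜ) : ℕ)

/-- `G` is a `φ`-expander: every cut with two sides of positive volume has conductance at
least `φ`. -/
def IsExpander (φ : ℝ) : Prop :=
  ∀ S : Finset V, 0 < vol G S → 0 < vol G Sᶜ → φ ≤ conductance G S

end Expander

/-! ### The adversarial CONGEST model -/

/-- Bit strings of length `k`. -/
abbrev Bits (k : ℕ) : Type := Fin k → Bool

/-- What a node knows about the instance at the start: its own identifier, the identifiers of its
neighbours, and the broadcast message if it is the source (`none` at every other node). -/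
structure LocalInput (idLen msgLen : ℕ) where
  ownId : Bits idLen
  nbrIds : Finset (Bits idLen)
  source : Option (Bits msgLen)

/-- A randomized synchronous message-passing algorithm, given as the program that every node runs.
Identifiers have `idLen` bits, the broadcast message has `msgLen` bits, and in each round a node
sends to each neighbour one message of `bw` bits, or nothing (`none`). Local computation is
unrestricted, and each node has `coinLen` private random bits. -/
structure Algorithm (idLen msgLen bw : ℕ) where
  /-- local states of a node -/
  State : Type
  /-- number of random bits of a node -/
  coinLen : ℕ
  /-- number of communication rounds, after which every node produces its output -/
  rounds : ℕ
  /-- initial state, from the local input and the node's own random bits -/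
  init : LocalInput idLen msgLen → Bits coinLen → State
  /-- message to be sent in the current round to the neighbour with a given identifier -/
  send : State → Bits idLen → Option (Bits bw)
  /-- new state, from the messages received in the current round, indexed by the identifier of
  the neighbour at the other end of the edge -/
  step : State → (Bits idLen → Option (Bits bw)) → State
  /-- output of a node -/
  output : State → Option (Bits msgLen)

/-- A table of messages, one (or none) for each ordered pair (sender, receiver). -/
abbrev Traffic (V : Type*) (bw : ℕ) := V → V → Option (Bits bw)

/-- The strategy of an adaptive, computationally unbounded adversary. From the random bits of all
the nodes and the list of all messages that the nodes have sent in the network up to and including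
the current round (oldest first), it determines the messages that it puts on the edges it controls,
separately for each direction. -/
abbrev Strategy (V : Type*) (coinLen bw : ℕ) :=
  (V → Bits coinLen) → List (Traffic V bw) → Traffic V bw

section Execution

variable {V : Type*} [Fintype V] [DecidableEq V] (G : SimpleGraph V) [DecidableRel G.Adj]
  {idLen msgLen bw : ℕ} (id : V → Bits idLen)

/-- The local input of node `v` when `s` is the source and `m₀` its message. -/
def localInput (s : V) (m₀ : Bits msgLen) (v : V) : LocalInput idLen msgLen where
  ownId := id v
  nbrIds := (G.neighborFinset v).image id
  source := if v = s then some m₀ else none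

/-- The messages that the nodes send along the edges of `G` when they are in the states `σ`. -/
def sent (A : Algorithm idLen msgLen bw) (σ : V → A.State) : Traffic V bw :=
  fun u v => if G.Adj u v then A.send (σ u) (id v) else none

/-- The messages that arrive: on the edges of `F` those of the adversary, on all other edges those
that were sent. -/
def delivered (F : Finset (Sym2 V)) (honest adversarial : Traffic V bw) : Traffic V bw :=
  fun u v => if s(u, v) ∈ F then adversarial u v else honest u v

/-- The messages that `v` receives, indexed by the identifiers of the senders. -/
noncomputable def inbox (d : Traffic V bw) (v : V) : Bits idLen → Option (Bits bw) :=
  Function.extend id (fun u => d u v) (fun _ => none)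

/-- The states of all nodes after `r` rounds, with the messages that the nodes sent in these
rounds. -/
noncomputable def run (A : Algorithm idLen msgLen bw) (s : V) (m₀ : Bits msgLen)
    (F : Finset (Sym2 V)) (adv : Strategy V A.coinLen bw) (ω : V → Bits A.coinLen) :
    ℕ → (V → A.State) × List (Traffic V bw)
  | 0 => (fun v => A.init (localInput G id s m₀ v) (ω v), [])
  | r + 1 =>
    let σ := (run A s m₀ F adv ω r).1
    let hist := (run A s m₀ F adv ω r).2 ++ [sent G id A σ]
    let d := delivered F (sent G id A σ) (adv ω hist)
    (fun v => A.step (σ v) (inbox id d v), hist)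

/-- At the end of the execution every node outputs the message of the source. -/
def BroadcastSucceeds (A : Algorithm idLen msgLen bw) (s : V) (m₀ : Bits msgLen)
    (F : Finset (Sym2 V)) (adv : Strategy V A.coinLen bw) (ω : V → Bits A.coinLen) : Prop :=
  ∀ v, A.output ((run G id A s m₀ F adv ω A.rounds).1 v) = some m₀

/-- The probability that the broadcast succeeds, when the random bits of the nodes are independent
and uniform. -/
noncomputable def successProb (A : Algorithm idLen msgLen bw) (s : V) (m₀ : Bits msgLen)
    (F : Finset (Sym2 V)) (adv : Strategy V A.coinLen bw) : ℝ :=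
  (ProbabilityTheory.uniformOn (Set.univ : Set (V → Bits A.coinLen))).real
    {ω | BroadcastSucceeds G id A s m₀ F adv ω}

end Execution

end AdvCongest

/-! Every node privately gives each identifier one of `2 ^ q` random colours, with `4t < 2 ^ q ≤
8t`; the ordered pair `(u, v)` gets the colour that `v` gives to `u`. For each colour, the message
is flooded along the pairs of that colour, and each node outputs the majority value over the
colours. A controlled edge touches at most two colours, one per direction, so fewer than half of the
colours are touched (`card_not_cleanColour_le`). In an untouched (clean) colour only `m₀` is ever
accepted, so it remains to see that flooding reaches every node in each clean colour.

This follows from the property `Spreading`, demanded of all colours at once. Applied with `H` the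
set of newly reached vertices, it shows that one phase of flooding adds vertices whose degree sum
exceeds half of the current cut. By expansion the degree sum of the reached set then grows
geometrically up to half of the total, after which the remainder shrinks geometrically
(`Spreading.eq_univ`).

`Spreading` holds with high probability by a union bound over colours and pairs `(S, H)`
(`card_not_spreading_le`). A pair fails with probability at most `n ^ (-(c + 6) * (min |S| |Sᶜ| +
|H|))`, which pays for the number of pairs. The event depends on the coins alone, not on `F` or the
strategy, so an adversary who knows all coins gains nothing. -/

namespace AdvCongest

/-! ### Expansion of cuts in terms of degree sums -/

section DegreeSum

variable {V : Type*} [Fintype V] (G : SimpleGraph V) [DecidableRel G.Adj]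

/-- The sum of the degrees of the vertices in `S`. -/
def degSum (S : Finset V) : ℕ := ∑ v ∈ S, G.degree v

variable {G} in
lemma degSum_mono {S T : Finset V} (h : S ⊆ T) : degSum G S ≤ degSum G T :=
  Finset.sum_le_sum_of_subset h

lemma minDegree_mul_card_le_degSum (S : Finset V) : G.minDegree * S.card ≤ degSum G S := by
  rw [mul_comm, ← smul_eq_mul]
  exact Finset.card_nsmul_le_sum _ _ _ fun v _ => G.minDegree_le_degree v

lemma degSum_univ_le : degSum G Finset.univ ≤ Fintype.card V ^ 2 := by
  rw [sq, ← smul_eq_mul, ← Finset.card_univ]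
  exact Finset.sum_le_card_nsmul _ _ _ fun v _ => by
    rw [Finset.card_univ]; exact (G.degree_lt_card_verts v).le

variable {G} in
lemma degSum_pos (hd : 0 < G.minDegree) {S : Finset V} (hS : S.Nonempty) : 0 < degSum G S :=
  (Nat.mul_pos hd hS.card_pos).trans_le (minDegree_mul_card_le_degSum G S)

end DegreeSum

/-! ### Cuts, volumes and degree sums -/

section Graph

variable {V : Type*} [Fintype V] [DecidableEq V] (G : SimpleGraph V) [DecidableRel G.Adj]

lemma cutSize_le_card_interedges (S : Finset V) :
    cutSize G S ≤ (G.interedges S Sᶜ).card := by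
  unfold cutSize
  refine (Finset.card_le_card (t := (G.interedges S Sᶜ).image fun p => s(p.1, p.2)) ?_).trans
    Finset.card_image_le
  intro e he
  simp only [Finset.mem_filter, SimpleGraph.mem_edgeFinset] at he
  obtain ⟨he, ⟨u, hu, hue⟩, v, hv, hve⟩ := he
  have huv : u ≠ v := by
    rintro rfl
    exact (Finset.mem_compl.mp hv) hu
  have hee : e = s(u, v) := (Sym2.mem_and_mem_iff huv).mp ⟨hue, hve⟩
  subst hee
  exact Finset.mem_image.mpr ⟨(u, v), G.mem_interedges_iff.mpr ⟨hu, hv, he⟩, rfl⟩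

lemma degSum_le_two_mul_vol (S : Finset V) : degSum G S ≤ 2 * vol G S := by
  have h1 : degSum G S = ∑ e ∈ G.edgeFinset, (S.filter fun v => v ∈ e).card := by
    refine Eq.trans ?_
      (Finset.sum_card_bipartiteAbove_eq_sum_card_bipartiteBelow fun (v : V) (e : Sym2 V) => v ∈ e)
    refine Finset.sum_congr rfl fun v _ => ?_
    rw [← G.card_incidenceFinset_eq_degree, SimpleGraph.incidenceFinset_eq_filter]
    rfl
  have h2 : ∀ e ∈ G.edgeFinset, (S.filter fun v => v ∈ e).card
      ≤ if ∃ v ∈ S, v ∈ e then 2 else 0 := by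
    intro e _
    split_ifs with h
    · induction e with | _ x y =>
      refine (Finset.card_le_card (t := {x, y}) ?_).trans Finset.card_le_two
      intro v hv
      simpa using (Finset.mem_filter.mp hv).2
    · rw [Nat.le_zero, Finset.card_eq_zero, Finset.filter_eq_empty_iff]
      exact fun v hv hve => h ⟨v, hv, hve⟩
  rw [h1]
  refine (Finset.sum_le_sum h2).trans ?_
  rw [← Finset.sum_filter, Finset.sum_const, smul_eq_mul, mul_comm]
  rfl

lemma degSum_add_degSum_compl (S : Finset V) :
    degSum G S + degSum G Sᶜ = degSum G Finset.univ :=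
  Finset.sum_add_sum_compl S _

variable {G}

lemma vol_pos (hd : 0 < G.minDegree) {S : Finset V} (hS : S.Nonempty) : 0 < vol G S := by
  have := degSum_pos hd hS
  have := degSum_le_two_mul_vol G S
  omega

lemma IsExpander.mul_min_vol_le {φ : ℝ} (hG : IsExpander G φ) (hd : 0 < G.minDegree)
    {S : Finset V} (hS : S.Nonempty) (hS' : Sᶜ.Nonempty) :
    φ * (min (vol G S) (vol G Sᶜ) : ℕ) ≤ cutSize G S := by
  have h1 := vol_pos hd hS
  have h2 := vol_pos hd hS'
  have h := hG S h1 h2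
  rwa [conductance, le_div_iff₀ (by exact_mod_cast lt_min h1 h2)] at h

/-- Degree sums replace volumes because they are additive over vertices; the price is a factor 2,
since an edge is counted at most twice. -/
lemma IsExpander.mul_min_degSum_le {φ : ℝ} (hφ : 0 < φ) (hG : IsExpander G φ)
    (hd : 0 < G.minDegree) {S : Finset V} (hS : S.Nonempty) (hS' : Sᶜ.Nonempty) :
    φ / 2 * (min (degSum G S) (degSum G Sᶜ) : ℕ) ≤ (G.interedges S Sᶜ).card := by
  have h1 := hG.mul_min_vol_le hd hS hS'
  have h2 : (cutSize G S : ℝ) ≤ (G.interedges S Sᶜ).card := by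
    exact_mod_cast cutSize_le_card_interedges G S
  have h3 : min (degSum G S) (degSum G Sᶜ) ≤ 2 * min (vol G S) (vol G Sᶜ) := by
    have := degSum_le_two_mul_vol G S
    have := degSum_le_two_mul_vol G Sᶜ
    omega
  have h4 : ((min (degSum G S) (degSum G Sᶜ) : ℕ) : ℝ) ≤ 2 * (min (vol G S) (vol G Sᶜ) : ℕ) := by
    exact_mod_cast h3
  nlinarith

/-- A cut has at most as many edges as are incident to either side; a singleton supplies a cut with
both volumes positive. -/
lemma IsExpander.le_one {φ : ℝ} (hG : IsExpander G φ) (hd : 0 < G.minDegree) (v : V) :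
    φ ≤ 1 := by
  have hv : 0 < G.degree v := hd.trans_le (G.minDegree_le_degree v)
  obtain ⟨w, hw⟩ := (G.degree_pos_iff_exists_adj v).mp hv
  have hS : ({v} : Finset V).Nonempty := Finset.singleton_nonempty v
  have hS' : ({v} : Finset V)ᶜ.Nonempty := ⟨w, by simpa using hw.ne'⟩
  have h := hG.mul_min_vol_le hd hS hS'
  have hpos : 0 < min (vol G {v}) (vol G {v}ᶜ) := lt_min (vol_pos hd hS) (vol_pos hd hS')
  have hle : cutSize G {v} ≤ min (vol G {v}) (vol G {v}ᶜ) := by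
    refine le_min ?_ ?_ <;> refine Finset.card_le_card fun e he => ?_ <;>
      rw [Finset.mem_filter] at he ⊢
    exacts [⟨he.1, he.2.1⟩, ⟨he.1, he.2.2⟩]
  have hle' : (cutSize G {v} : ℝ) ≤ (min (vol G {v}) (vol G {v}ᶜ) : ℕ) := by exact_mod_cast hle
  have hpos' : (0 : ℝ) < (min (vol G {v}) (vol G {v}ᶜ) : ℕ) := by exact_mod_cast hpos
  by_contra! hlt
  nlinarith

-- Only the cut edges ending in `H` are lost, at most the degree sum of `H`.
variable (G) in
lemma card_interedges_compl_le (S H : Finset V) :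
    (G.interedges S Sᶜ).card ≤ (G.interedges S (S ∪ H)ᶜ).card + degSum G H := by
  have h : G.interedges S Sᶜ ⊆
      G.interedges S (S ∪ H)ᶜ ∪ H.biUnion fun v => (G.neighborFinset v).image fun u => (u, v) := by
    rintro ⟨u, v⟩ huv
    obtain ⟨hu, hv, h⟩ := G.mem_interedges_iff.mp huv
    rw [Finset.mem_union]
    by_cases hH : v ∈ H
    · right
      simp only [Finset.mem_biUnion, Finset.mem_image, SimpleGraph.mem_neighborFinset]
      exact ⟨v, hH, u, h.symm, rfl⟩
    · left
      refine G.mem_interedges_iff.mpr ⟨hu, ?_, h⟩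
      simp_all
  refine (Finset.card_le_card h).trans ((Finset.card_union_le _ _).trans ?_)
  gcongr
  exact Finset.card_biUnion_le.trans (Finset.sum_le_sum fun v _ => Finset.card_image_le)

end Graph

/-! ### Growth of the flooded set -/

/-- Two stretches of `E` steps: below `M / 2` the value gains a factor `1 + ε ≥ exp (ε / 2)` per
step, above it the remainder loses a factor `1 - ε ≤ exp (-ε / 2)`. Either stretch changes its
quantity by a factor larger than `M`. -/
lemma compl_lt_one_of_growth {f : ℕ → ℝ} {M ε : ℝ} {E : ℕ} (hε : 0 < ε) (hε1 : ε ≤ 1)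
    (h0 : 1 ≤ f 0) (hM : ∀ j, f j ≤ M) (hf : ∀ j, f j + ε * min (f j) (M - f j) ≤ f (j + 1))
    (hE : M < Real.exp (ε / 2 * E)) : M - f (2 * E) < 1 := by
  have hexp : Real.exp (ε / 2) ≤ 1 + ε := by
    have := Real.abs_exp_sub_one_le (x := ε / 2) (by rw [abs_of_pos] <;> linarith)
    rw [abs_of_pos (half_pos hε)] at this
    linarith [le_abs_self (Real.exp (ε / 2) - 1)]
  have hpos : ∀ j, 1 ≤ f j := by
    intro j
    induction j with
    | zero => exact h0
    | succ j ih =>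
      have : 0 ≤ ε * min (f j) (M - f j) :=
        mul_nonneg hε.le (le_min (by linarith) (by linarith [hM j]))
      linarith [hf j]
  have hmono : ∀ j, f j ≤ f (j + 1) := fun j => by
    have : 0 ≤ ε * min (f j) (M - f j) :=
      mul_nonneg hε.le (le_min (by linarith [hpos j]) (by linarith [hM j]))
    linarith [hf j]
  have hphase : ∀ j, M - f j ≤ f j ∨ Real.exp (ε / 2 * j) ≤ f j := by
    intro j
    induction j with
    | zero => right; simpa using h0
    | succ j ih =>
      have := hmono j
      by_cases h : M - f j ≤ f j
      · left; linarith
      · right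
        have ih := ih.resolve_left h
        have h1 := hf j
        rw [min_eq_left (not_le.mp h).le] at h1
        calc Real.exp (ε / 2 * (j + 1 : ℕ)) = Real.exp (ε / 2 * j) * Real.exp (ε / 2) := by
              rw [← Real.exp_add]; push_cast; ring_nf
          _ ≤ f j * (1 + ε) := by gcongr; linarith [hpos j]
          _ ≤ f (j + 1) := by linarith
  -- Exponential growth for all `E` steps would exceed the bound `M`.
  have hhalf : M - f E ≤ f E :=
    (hphase E).resolve_right fun h => absurd (hM E) (not_le.mpr (hE.trans_le h))
  have hle : ∀ j, M - f (E + j) ≤ f (E + j) ∧ M - f (E + j) ≤ M * Real.exp (-(ε / 2 * j)) := by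
    intro j
    induction j with
    | zero => exact ⟨hhalf, by simpa using (zero_le_one.trans (hpos E))⟩
    | succ j ih =>
      have h0 := hmono (E + j)
      have h1 := hf (E + j)
      rw [min_eq_right ih.1] at h1
      have hr : (0 : ℝ) ≤ M - f (E + j) := by linarith [hM (E + j)]
      rw [← add_assoc]
      refine ⟨by linarith [ih.1], ?_⟩
      calc M - f (E + j + 1) ≤ (M - f (E + j)) * (1 - ε) := by linarith
        _ ≤ (M - f (E + j)) * Real.exp (-(ε / 2)) := by
            gcongr
            linarith [Real.add_one_le_exp (-(ε / 2))]
        _ ≤ M * Real.exp (-(ε / 2 * j)) * Real.exp (-(ε / 2)) := by gcongr; exact ih.2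
        _ = M * Real.exp (-(ε / 2 * (j + 1 : ℕ))) := by
            rw [mul_assoc, ← Real.exp_add]; push_cast; ring_nf
  have := (hle E).2
  rw [two_mul]
  refine this.trans_lt ?_
  rw [Real.exp_neg, ← div_eq_mul_inv, div_lt_one (Real.exp_pos _)]
  exact hE

section Flooding

variable {V : Type*} [Fintype V] [DecidableEq V] (G : SimpleGraph V) [DecidableRel G.Adj]

/-- The relation `R` (where `R u v` means that messages pass from `u` to `v`) leads from every
proper nonempty vertex set `S` to new vertices, even after the removal of any set `H` of vertices
whose degree sum is at most half the size of the cut of `S`. -/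
def Spreading (R : V → V → Prop) : Prop :=
  ∀ S H : Finset V, S.Nonempty → Sᶜ.Nonempty → 2 * degSum G H ≤ (G.interedges S Sᶜ).card →
    ∃ p ∈ G.interedges S (S ∪ H)ᶜ, R p.1 p.2

variable {G}

/-- The growth rate is `ε = φ / 4` and the total degree is at most `n ^ 2`, so `exp (ε / 2 * E)`
exceeds it once `E > 16 log n / φ`. -/
lemma Spreading.eq_univ {R : V → V → Prop} (hR : Spreading G R) {φ : ℝ} (hφ : 0 < φ)
    (hG : IsExpander G φ) (hd : 0 < G.minDegree) {S : ℕ → Finset V} (h0 : (S 0).Nonempty)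
    (hmono : ∀ j, S j ⊆ S (j + 1))
    (hS : ∀ j, ∀ u ∈ S j, ∀ v, G.Adj u v → R u v → v ∈ S (j + 1)) {E : ℕ}
    (hE : 16 * Real.log (Fintype.card V) / φ < E) : S (2 * E) = Finset.univ := by
  have hφ1 : φ ≤ 1 := hG.le_one hd h0.choose
  have hne : ∀ j, (S j).Nonempty := fun j => by
    induction j with
    | zero => exact h0
    | succ j ih => exact ih.mono (hmono j)
  have hstep : ∀ j, (degSum G (S j) : ℝ) + φ / 4 * min (degSum G (S j) : ℝ)
      (degSum G Finset.univ - degSum G (S j)) ≤ degSum G (S (j + 1)) := by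
    intro j
    have hsum : (degSum G Finset.univ : ℝ) - degSum G (S j) = degSum G (S j)ᶜ := by
      rw [← degSum_add_degSum_compl G (S j)]; push_cast; ring
    rw [hsum]
    rcases (S j)ᶜ.eq_empty_or_nonempty with hc | hc
    · have h : (degSum G (S j) : ℝ) ≤ degSum G (S (j + 1)) := by
        exact_mod_cast degSum_mono (hmono j)
      have h0 : degSum G (S j)ᶜ = 0 := by rw [hc]; rfl
      rw [h0, Nat.cast_zero, min_eq_right (Nat.cast_nonneg _), mul_zero, add_zero]
      exact h
    -- If the new vertices were light, they could serve as `H`; `Spreading` would then yield a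
    -- vertex reached in this step but outside the set of new vertices.
    · have hlt : (G.interedges (S j) (S j)ᶜ).card < 2 * degSum G (S (j + 1) \ S j) := by
        by_contra! hle
        obtain ⟨⟨u, v⟩, hp, hRp⟩ := hR _ _ (hne j) hc hle
        obtain ⟨hu, hv, huv⟩ := G.mem_interedges_iff.mp hp
        have := hS j u hu v huv hRp
        simp_all
      have hadd : degSum G (S (j + 1) \ S j) + degSum G (S j) = degSum G (S (j + 1)) :=
        Finset.sum_sdiff (hmono j)
      have hexp := hG.mul_min_degSum_le hφ hd (hne j) hc
      have hlt' : ((G.interedges (S j) (S j)ᶜ).card : ℝ) < 2 * degSum G (S (j + 1) \ S j) := by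
        exact_mod_cast hlt
      have hadd' : (degSum G (S (j + 1) \ S j) : ℝ) + degSum G (S j) = degSum G (S (j + 1)) := by
        exact_mod_cast hadd
      rw [Nat.cast_min] at hexp
      linarith
  have hcard : (1 : ℝ) ≤ Fintype.card V := by
    exact_mod_cast Fintype.card_pos_iff.mpr ⟨h0.choose⟩
  have hlt := compl_lt_one_of_growth (f := fun j => (degSum G (S j) : ℝ)) (E := E)
    (M := degSum G Finset.univ) (ε := φ / 4)
    (by positivity) (by linarith) (by exact_mod_cast degSum_pos hd h0)
    (fun j => by exact_mod_cast degSum_mono (Finset.subset_univ _)) hstep (by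
      have h1 : (degSum G Finset.univ : ℝ) ≤ (Fintype.card V : ℝ) ^ 2 := by
        exact_mod_cast degSum_univ_le G
      refine h1.trans_lt ?_
      rw [← Real.exp_log (show (0 : ℝ) < (Fintype.card V : ℝ) ^ 2 by positivity), Real.exp_lt_exp,
        Real.log_pow]
      rw [div_lt_iff₀ hφ] at hE
      push_cast
      linarith)
  -- Degree sums are integers, so a remainder below 1 is 0, and positive minimum degree makes the
  -- unreached set empty.
  have hlt' : degSum G Finset.univ < degSum G (S (2 * E)) + 1 := by
    have : (degSum G Finset.univ : ℝ) < degSum G (S (2 * E)) + 1 := by linarith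
    exact_mod_cast this
  by_contra hne'
  have hc : (S (2 * E))ᶜ.Nonempty := by
    rwa [Finset.nonempty_iff_ne_empty, ne_eq, Finset.compl_eq_empty_iff]
  have := degSum_pos hd hc
  have := degSum_add_degSum_compl G (S (2 * E))
  omega

end Flooding

end AdvCongest

namespace AdvCongest

/-! ### Random colourings -/

section Probability

/-- The coordinates are independent, so the proportion is `(1 - 1 / Q) ^ |P|`. -/
lemma card_avoiding_le {X I : Type*} [Fintype X] [Fintype I] [DecidableEq X] [DecidableEq I]
    {Q : ℕ} (i : Fin Q) (P : Finset (X × I)) :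
    ((Finset.univ.filter fun ω : X → I → Fin Q => ∀ p ∈ P, ω p.1 p.2 ≠ i).card : ℝ)
      ≤ Real.exp (-(P.card / Q)) * Fintype.card (X → I → Fin Q) := by
  have hQ : (1 : ℝ) ≤ Q := by exact_mod_cast i.pos
  have h1 : (Finset.univ.filter fun ω : X → I → Fin Q => ∀ p ∈ P, ω p.1 p.2 ≠ i).card
      = (Fintype.piFinset fun p : X × I => if p ∈ P then {i}ᶜ else Finset.univ).card := by
    refine Finset.card_equiv (Equiv.curry X I (Fin Q)).symm fun ω => ?_
    simp only [Finset.mem_filter, Finset.mem_univ, true_and, Fintype.mem_piFinset]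
    refine forall_congr' fun p => ?_
    by_cases hp : p ∈ P <;> simp [hp, Equiv.curry, Function.uncurry]
  have h2 : (Fintype.card (X → I → Fin Q) : ℝ) = ∏ _p : X × I, (Q : ℝ) := by
    rw [Fintype.card_congr (Equiv.curry X I (Fin Q)).symm]
    simp
  have h3 : Real.exp (-(P.card / Q)) = ∏ p : X × I, if p ∈ P then Real.exp (-(1 / Q)) else 1 := by
    rw [Finset.prod_ite_mem, Finset.univ_inter, Finset.prod_const, ← Real.exp_nat_mul]
    ring_nf
  rw [h1, Fintype.card_piFinset, h2, h3, ← Finset.prod_mul_distrib, Nat.cast_prod]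
  refine Finset.prod_le_prod (fun _ _ => Nat.cast_nonneg _) fun p _ => ?_
  split_ifs
  · rw [Finset.card_compl, Finset.card_singleton, Fintype.card_fin, Nat.cast_sub i.pos]
    have := Real.add_one_le_exp (-(1 / (Q : ℝ)))
    calc (Q : ℝ) - (1 : ℕ) = (-(1 / (Q : ℝ)) + 1) * Q := by field_simp; push_cast; ring
      _ ≤ _ := by gcongr
  · simp

lemma sum_pow_card_finset (V : Type*) [Fintype V] (z : ℝ) :
    ∑ H : Finset V, z ^ H.card = (z + 1) ^ Fintype.card V := by
  simpa using Fintype.sum_pow_mul_eq_add_pow V z 1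

/-- Leaving out the empty set removes the term 1, so the bound tends to 0 with `z`. -/
lemma sum_pow_card_proper_le {V : Type*} [Fintype V] [DecidableEq V] {z : ℝ} (hz : 0 ≤ z) :
    ∑ S : Finset V with S.Nonempty ∧ Sᶜ.Nonempty, (z ^ S.card + z ^ Sᶜ.card)
      ≤ 2 * ((z + 1) ^ Fintype.card V - 1) := by
  have h1 : ∑ S : Finset V with S.Nonempty ∧ Sᶜ.Nonempty, z ^ Sᶜ.card
      = ∑ S : Finset V with S.Nonempty ∧ Sᶜ.Nonempty, z ^ S.card :=
    Finset.sum_nbij' compl compl (by simp [and_comm]) (by simp [and_comm]) (by simp) (by simp)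
      (by simp)
  have h2 : ∑ S : Finset V with S.Nonempty ∧ Sᶜ.Nonempty, z ^ S.card
      ≤ ∑ S ∈ Finset.univ.erase (∅ : Finset V), z ^ S.card := by
    refine Finset.sum_le_sum_of_subset_of_nonneg (fun S hS => ?_) fun _ _ _ => by positivity
    rw [Finset.mem_filter] at hS
    exact Finset.mem_erase.mpr ⟨hS.2.1.ne_empty, Finset.mem_univ _⟩
  have h3 := Finset.add_sum_erase Finset.univ (fun S : Finset V => z ^ S.card)
    (Finset.mem_univ ∅)
  rw [sum_pow_card_finset] at h3
  simp only [Finset.card_empty, pow_zero] at h3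
  rw [Finset.sum_add_distrib, h1]
  linarith

/-! ### Union bound over colours, cuts and removed sets -/

variable {V I : Type*} [Fintype V] [DecidableEq V] [Fintype I] [DecidableEq I]
  {G : SimpleGraph V} [DecidableRel G.Adj]

/-- At least half of the cut survives the removal of `H`, and distinct surviving pairs read
independent colours. The bound decays in `|H|` as well as in the smaller side of the cut, so that
the sum over all `H` stays bounded. -/
lemma card_blocking_le {φ γ z : ℝ} {Q : ℕ} {id : V → I} (hid : Function.Injective id)
    (hφ : 0 < φ) (hφ1 : φ ≤ 1) (hG : IsExpander G φ) (hd : 0 < G.minDegree)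
    (hγ : 5 * γ * Q ≤ φ * G.minDegree) (hz : z = Real.exp (-γ)) (i : Fin Q) {S H : Finset V}
    (hS : S.Nonempty) (hS' : Sᶜ.Nonempty) (hH : 2 * degSum G H ≤ (G.interedges S Sᶜ).card) :
    ((Finset.univ.filter fun ω : V → I → Fin Q =>
      ∀ p ∈ G.interedges S (S ∪ H)ᶜ, ω p.2 (id p.1) ≠ i).card : ℝ)
      ≤ (z ^ S.card + z ^ Sᶜ.card) * z ^ H.card * Fintype.card (V → I → Fin Q) := by
  have hQ : (0 : ℝ) < Q := by exact_mod_cast i.pos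
  set P := G.interedges S (S ∪ H)ᶜ with hP
  have hinj : Function.Injective fun p : V × V => (p.2, id p.1) := by
    rintro ⟨u, v⟩ ⟨u', v'⟩ h
    simp only [Prod.mk.injEq] at h
    rw [hid h.2, h.1]
  have hcard : (P.image fun p => (p.2, id p.1)).card = P.card :=
    Finset.card_image_of_injective _ hinj
  have havoid := card_avoiding_le i (P.image fun p => (p.2, id p.1))
  rw [hcard] at havoid
  simp only [Finset.forall_mem_image] at havoid
  refine havoid.trans ?_
  gcongr
  set k := min S.card Sᶜ.card with hk
  set e := (G.interedges S Sᶜ).card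
  have h1 : (e : ℝ) ≤ P.card + degSum G H := by exact_mod_cast card_interedges_compl_le G S H
  have h2 : 2 * (degSum G H : ℝ) ≤ e := by exact_mod_cast hH
  have h3 : (G.minDegree : ℝ) * H.card ≤ degSum G H := by
    exact_mod_cast minDegree_mul_card_le_degSum G H
  have h4 : (G.minDegree : ℝ) * k ≤ (min (degSum G S) (degSum G Sᶜ) : ℕ) := by
    have : G.minDegree * k ≤ min (degSum G S) (degSum G Sᶜ) :=
      le_min ((Nat.mul_le_mul_left _ (min_le_left _ _)).trans (minDegree_mul_card_le_degSum G S))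
        ((Nat.mul_le_mul_left _ (min_le_right _ _)).trans (minDegree_mul_card_le_degSum G Sᶜ))
    exact_mod_cast this
  have h5 := hG.mul_min_degSum_le hφ hd hS hS'
  have h6 : φ / 2 * (G.minDegree * k) ≤ e := (by gcongr : _ ≤ _).trans h5
  have h7 : φ * (G.minDegree * H.card) ≤ G.minDegree * H.card :=
    mul_le_of_le_one_left (by positivity) hφ1
  have h8 : 5 * γ * Q * (k + H.card) ≤ φ * G.minDegree * (k + H.card) := by gcongr
  -- With `d` the minimum degree, `φ * d * k ≤ 2 * e` and `φ * d * |H| ≤ e / 2`, together at most `5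
  -- / 2 * e ≤ 5 * |P|`; hence the constant 5 in `hγ`.
  have h9 : γ * (k + H.card) ≤ P.card / Q := by
    rw [le_div_iff₀ hQ]
    have : (0 : ℝ) ≤ e := Nat.cast_nonneg _
    nlinarith
  have h10 : Real.exp (-(P.card / Q)) ≤ z ^ k * z ^ H.card := by
    rw [← pow_add, hz, ← Real.exp_nat_mul, Real.exp_le_exp]
    push_cast
    linarith
  have hz0 : 0 < z := hz ▸ Real.exp_pos _
  refine h10.trans ?_
  gcongr
  -- The sum of both powers dominates the power with exponent `k`, and can be summed over `S`
  -- without a minimum.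
  rcases min_choice S.card Sᶜ.card with h | h <;> rw [hk, h] <;>
    [exact le_add_of_nonneg_right (by positivity); exact le_add_of_nonneg_left (by positivity)]

open Classical in
lemma card_not_spreading_le {φ γ z : ℝ} {Q : ℕ} {id : V → I} (hid : Function.Injective id)
    (hφ : 0 < φ) (hφ1 : φ ≤ 1) (hG : IsExpander G φ) (hd : 0 < G.minDegree)
    (hγ : 5 * γ * Q ≤ φ * G.minDegree) (hz : z = Real.exp (-γ)) :
    ((Finset.univ.filter fun ω : V → I → Fin Q =>
      ∃ i, ¬ Spreading G fun u v => ω v (id u) = i).card : ℝ)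
      ≤ Q * (2 * ((z + 1) ^ Fintype.card V - 1) * (z + 1) ^ Fintype.card V) *
        Fintype.card (V → I → Fin Q) := by
  have hz0 : 0 < z := hz ▸ Real.exp_pos _
  set c : ℝ := (Fintype.card (V → I → Fin Q) : ℝ) with hc
  let T : Finset (Fin Q × Finset V × Finset V) :=
    Finset.univ ×ˢ (Finset.univ.filter fun S : Finset V => S.Nonempty ∧ Sᶜ.Nonempty) ×ˢ
      Finset.univ
  let A : Fin Q × Finset V × Finset V → Finset (V → I → Fin Q) := fun x =>
    if 2 * degSum G x.2.2 ≤ (G.interedges x.2.1 x.2.1ᶜ).card then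
      Finset.univ.filter fun ω =>
        ∀ p ∈ G.interedges x.2.1 (x.2.1 ∪ x.2.2)ᶜ, ω p.2 (id p.1) ≠ x.1
    else ∅
  have hsub : (Finset.univ.filter fun ω : V → I → Fin Q =>
      ∃ i, ¬ Spreading G fun u v => ω v (id u) = i) ⊆ T.biUnion A := by
    intro ω hω
    obtain ⟨i, hi⟩ := (Finset.mem_filter.mp hω).2
    unfold Spreading at hi
    push Not at hi
    obtain ⟨S, H, hS, hS', hH, hp⟩ := hi
    refine Finset.mem_biUnion.mpr ⟨(i, S, H), by simp [T, hS, hS'], ?_⟩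
    simp only [A]
    rw [if_pos hH]
    exact Finset.mem_filter.mpr ⟨Finset.mem_univ _, hp⟩
  have hA : ∀ x ∈ T, ((A x).card : ℝ)
      ≤ (z ^ x.2.1.card + z ^ x.2.1ᶜ.card) * z ^ x.2.2.card * c := by
    intro x hx
    have hx' : x.2.1.Nonempty ∧ x.2.1ᶜ.Nonempty := by
      simpa only [T, Finset.mem_product, Finset.mem_filter, Finset.mem_univ, true_and, and_true]
        using hx
    simp only [A]
    split_ifs with h
    · exact card_blocking_le hid hφ hφ1 hG hd hγ hz x.1 hx'.1 hx'.2 h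
    · simp only [Finset.card_empty, Nat.cast_zero]; positivity
  calc _ ≤ ((T.biUnion A).card : ℝ) := by exact_mod_cast Finset.card_le_card hsub
    _ ≤ ∑ x ∈ T, ((A x).card : ℝ) := by exact_mod_cast Finset.card_biUnion_le
    _ ≤ ∑ x ∈ T, (z ^ x.2.1.card + z ^ x.2.1ᶜ.card) * z ^ x.2.2.card * c := Finset.sum_le_sum hA
    _ = Q * ((∑ S : Finset V with S.Nonempty ∧ Sᶜ.Nonempty, (z ^ S.card + z ^ Sᶜ.card)) *
          ∑ H : Finset V, z ^ H.card) * c := by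
        rw [← Finset.sum_mul]
        simp only [T, Finset.sum_product, Finset.sum_const, Finset.card_univ, Fintype.card_fin,
          nsmul_eq_mul, Finset.sum_mul_sum]
    _ ≤ _ := by
        rw [sum_pow_card_finset]
        gcongr
        exact sum_pow_card_proper_le hz0.le

/-- Since `n * z ≤ 1`, the left side is at most `12 * n ^ 2 * z`, and `12 ≤ n ^ 4`; this explains
the exponent `c + 6`. -/
lemma union_bound_le {n c : ℕ} {Q z : ℝ} (hn : 2 ≤ n) (hQn : Q ≤ n)
    (hz : z = Real.exp (-((c + 6 : ℕ) * Real.log n))) :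
    Q * (2 * ((z + 1) ^ n - 1) * (z + 1) ^ n) ≤ 1 / (n : ℝ) ^ c := by
  have hn' : (2 : ℝ) ≤ n := by exact_mod_cast hn
  have hz0 : 0 < z := hz ▸ Real.exp_pos _
  have hz' : z * (n : ℝ) ^ (c + 6) = 1 := by
    rw [hz, Real.exp_neg, Real.exp_nat_mul, Real.exp_log (by linarith)]
    field_simp
  have hpow : (16 : ℝ) ≤ (n : ℝ) ^ 4 := by
    calc (16 : ℝ) = 2 ^ 4 := by norm_num
      _ ≤ _ := by gcongr
  have hnz : n * z ≤ 1 := by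
    rw [← hz', mul_comm]
    gcongr
    exact le_self_pow₀ (by linarith) (by omega)
  have hnz0 : 0 ≤ n * z := by positivity
  have h1 : (z + 1) ^ n ≤ 1 + 2 * (n * z) := by
    have h := Real.abs_exp_sub_one_le (x := n * z) (by rwa [abs_of_nonneg hnz0])
    rw [abs_of_nonneg hnz0] at h
    calc (z + 1) ^ n ≤ Real.exp z ^ n := by gcongr; exact Real.add_one_le_exp z
      _ = Real.exp (n * z) := (Real.exp_nat_mul _ _).symm
      _ ≤ _ := by linarith [le_abs_self (Real.exp (n * z) - 1)]
  have h1' : (1 : ℝ) ≤ (z + 1) ^ n := one_le_pow₀ (by linarith)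
  rw [le_div_iff₀ (by positivity)]
  calc Q * (2 * ((z + 1) ^ n - 1) * (z + 1) ^ n) * (n : ℝ) ^ c
      ≤ n * (2 * (2 * (n * z)) * 3) * (n : ℝ) ^ c := by
        gcongr
        · linarith
        · linarith
    _ = 12 * (z * (n : ℝ) ^ (c + 2)) := by ring
    _ ≤ (n : ℝ) ^ 4 * (z * (n : ℝ) ^ (c + 2)) := by gcongr; linarith
    _ = 1 := by rw [← hz']; ring

end Probability

end AdvCongest

namespace AdvCongest

/-! ### The flooding algorithm -/

section Flood

/-- Encoding of a choice of one of `2 ^ q` colours for each identifier by random bits. -/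
noncomputable def coinEquiv (idLen q : ℕ) :
    Bits (2 ^ idLen * q) ≃ (Bits idLen → Fin (2 ^ q)) :=
  Fintype.equivOfCardEq (by simp [← pow_mul, mul_comm])

/-- The colour that is flooded in round `r`. -/
def activeColour (q r : ℕ) : Fin (2 ^ q) := ⟨r % 2 ^ q, Nat.mod_lt _ (Nat.two_pow_pos q)⟩

/-- The state of a node: the number of elapsed rounds, the colour that the node assigns to each
sender, and for each colour the value accepted so far. -/
structure FloodState (idLen msgLen q : ℕ) where
  round : ℕ
  colour : Bits idLen → Fin (2 ^ q)
  val : Fin (2 ^ q) → Option (Bits msgLen)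

open Classical in
/-- A message received from some sender of colour `i`, if there is one. -/
noncomputable def accepted {idLen msgLen q : ℕ} (colour : Bits idLen → Fin (2 ^ q))
    (i : Fin (2 ^ q)) (received : Bits idLen → Option (Bits msgLen)) : Option (Bits msgLen) :=
  if h : ∃ m w, colour w = i ∧ received w = some m then some h.choose else none

open Classical in
/-- The value held in more than half of the colours, if there is one. -/
noncomputable def majority {msgLen q : ℕ} (val : Fin (2 ^ q) → Option (Bits msgLen)) :
    Option (Bits msgLen) :=
  if h : ∃ m, 2 ^ q < 2 * (Finset.univ.filter fun i => val i = some m).card then some h.choose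
  else none

/-- Each node privately assigns a random colour to each of its neighbours. The colours take turns:
in the rounds of colour `i` every node sends the value it holds for colour `i`, and a node without
such a value accepts one from the neighbours to which it assigned the colour `i`. At the end each
node outputs the value that it holds in the majority of the colours. -/
noncomputable def floodAlgorithm (idLen msgLen q rounds : ℕ) : Algorithm idLen msgLen msgLen where
  State := FloodState idLen msgLen q
  coinLen := 2 ^ idLen * q
  rounds := rounds
  init x ω := ⟨0, coinEquiv idLen q ω, fun _ => x.source⟩
  send σ _ := σ.val (activeColour q σ.round)
  step σ received :=
    ⟨σ.round + 1, σ.colour, fun i =>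
      if i = activeColour q σ.round ∧ σ.val i = none then accepted σ.colour i received
      else σ.val i⟩
  output σ := majority σ.val

lemma accepted_eq_some {idLen msgLen q : ℕ} {colour : Bits idLen → Fin (2 ^ q)}
    {i : Fin (2 ^ q)} {received : Bits idLen → Option (Bits msgLen)} {m : Bits msgLen}
    (h : accepted colour i received = some m) : ∃ w, colour w = i ∧ received w = some m := by
  unfold accepted at h
  split_ifs at h with hex
  rw [← Option.some.inj h]
  exact hex.choose_spec

lemma accepted_isSome {idLen msgLen q : ℕ} {colour : Bits idLen → Fin (2 ^ q)}
    {i : Fin (2 ^ q)} {received : Bits idLen → Option (Bits msgLen)} {m : Bits msgLen}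
    {w : Bits idLen} (hw : colour w = i) (hm : received w = some m) :
    ∃ m', accepted colour i received = some m' := by
  unfold accepted
  rw [dif_pos ⟨m, w, hw, hm⟩]
  exact ⟨_, rfl⟩

/-- Two distinct values cannot both occupy more than half of the colours, so the chosen value is
`m`. -/
lemma majority_eq_some {msgLen q : ℕ} {val : Fin (2 ^ q) → Option (Bits msgLen)}
    {m : Bits msgLen} (h : 2 ^ q < 2 * (Finset.univ.filter fun i => val i = some m).card) :
    majority val = some m := by
  classical
  have hex : ∃ m, 2 ^ q < 2 * (Finset.univ.filter fun i => val i = some m).card := ⟨m, h⟩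
  unfold majority
  rw [dif_pos hex]
  have hm := hex.choose_spec
  by_contra hne
  have hdisj : Disjoint (Finset.univ.filter fun i => val i = some m)
      (Finset.univ.filter fun i => val i = some hex.choose) := by
    refine Finset.disjoint_filter.mpr fun i _ h1 h2 => hne ?_
    rw [← h1, ← h2]
  have := Finset.card_union_of_disjoint hdisj
  have := Finset.card_le_univ ((Finset.univ.filter fun i => val i = some m) ∪
      (Finset.univ.filter fun i => val i = some hex.choose))
  rw [Fintype.card_fin] at this
  omega

/-- No controlled edge has colour `i` in any direction. -/
def CleanColour {V : Type*} {idLen q : ℕ} (id : V → Bits idLen) (F : Finset (Sym2 V))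
    (ω : V → Bits (2 ^ idLen * q)) (i : Fin (2 ^ q)) : Prop :=
  ∀ u v, s(u, v) ∈ F → coinEquiv idLen q (ω v) (id u) ≠ i

open Classical in
lemma card_not_cleanColour_le {V : Type*} {idLen q : ℕ} (id : V → Bits idLen)
    (F : Finset (Sym2 V)) (ω : V → Bits (2 ^ idLen * q)) :
    (Finset.univ.filter fun i => ¬ CleanColour id F ω i).card ≤ 2 * F.card := by
  have hsub : (Finset.univ.filter fun i => ¬ CleanColour id F ω i) ⊆
      F.biUnion fun e => {coinEquiv idLen q (ω e.out.1) (id e.out.2),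
        coinEquiv idLen q (ω e.out.2) (id e.out.1)} := by
    intro i hi
    have hi := (Finset.mem_filter.mp hi).2
    unfold CleanColour at hi
    push Not at hi
    obtain ⟨u, v, hF, hc⟩ := hi
    refine Finset.mem_biUnion.mpr ⟨s(u, v), hF, ?_⟩
    have hout : s((s(u, v)).out.1, (s(u, v)).out.2) = s(u, v) := Quot.out_eq _
    rcases Sym2.eq_iff.mp hout with ⟨h1, h2⟩ | ⟨h1, h2⟩ <;> rw [h1, h2] <;> simp [hc]
  refine (Finset.card_le_card hsub).trans (Finset.card_biUnion_le.trans ?_)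
  exact (Finset.sum_le_card_nsmul _ _ 2 fun e _ => Finset.card_le_two).trans_eq (mul_comm _ _)

/-! ### Executions restricted to a clean colour -/

variable {V : Type*} [Fintype V] [DecidableEq V] {G : SimpleGraph V} [DecidableRel G.Adj]
  {idLen msgLen q R : ℕ} {id : V → Bits idLen} (s : V) (m₀ : Bits msgLen)
  {F : Finset (Sym2 V)}
  (adv : Strategy V (floodAlgorithm idLen msgLen q R).coinLen msgLen)
  (ω : V → Bits (2 ^ idLen * q))

variable (G id F) in
/-- The state of node `v` after `r` rounds of the flooding algorithm. -/
noncomputable def floodState (r : ℕ) (v : V) : FloodState idLen msgLen q :=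
  (run G id (floodAlgorithm idLen msgLen q R) s m₀ F adv ω r).1 v

lemma floodState_round_colour (r : ℕ) (v : V) :
    (floodState G id s m₀ F adv ω r v).round = r ∧
      (floodState G id s m₀ F adv ω r v).colour = coinEquiv idLen q (ω v) := by
  induction r with
  | zero => exact ⟨rfl, rfl⟩
  | succ r ih => exact ⟨congrArg (· + 1) ih.1, ih.2⟩

-- Isolates one colour from the execution: every identifier coloured `i` either belongs to a node
-- whose message arrives untouched, or to no node, and then nothing arrives.
variable {ω} in
lemma floodState_succ {i : Fin (2 ^ q)} (hid : Function.Injective id)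
    (hi : CleanColour id F ω i) (r : ℕ) (v : V) :
    ∃ received : Bits idLen → Option (Bits msgLen),
      (floodState G id s m₀ F adv ω (r + 1) v).val i =
        (if i = activeColour q r ∧ (floodState G id s m₀ F adv ω r v).val i = none
          then accepted (coinEquiv idLen q (ω v)) i received
          else (floodState G id s m₀ F adv ω r v).val i) ∧
      (∀ u, coinEquiv idLen q (ω v) (id u) = i → received (id u) =
        if G.Adj u v then (floodState G id s m₀ F adv ω r u).val (activeColour q r) else none) ∧
      ∀ w, (∀ u, id u ≠ w) → received w = none := by
  let σ := (run G id (floodAlgorithm idLen msgLen q R) s m₀ F adv ω r).1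
  let honest := sent G id (floodAlgorithm idLen msgLen q R) σ
  let received : Bits idLen → Option (Bits msgLen) := inbox id (delivered F honest
    (adv ω ((run G id (floodAlgorithm idLen msgLen q R) s m₀ F adv ω r).2 ++ [honest]))) v
  refine ⟨received, ?_, ?_, ?_⟩
  · have h := floodState_round_colour (G := G) (id := id) (F := F) s m₀ adv ω r v
    have h' : (floodState G id s m₀ F adv ω (r + 1) v).val i =
        (if i = activeColour q (floodState G id s m₀ F adv ω r v).round ∧
            (floodState G id s m₀ F adv ω r v).val i = none
          then accepted (floodState G id s m₀ F adv ω r v).colour i received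
          else (floodState G id s m₀ F adv ω r v).val i) := rfl
    rw [h', h.1, h.2]
  · intro u hu
    have hF : s(u, v) ∉ F := fun h => hi u v h hu
    have h := (floodState_round_colour (G := G) (id := id) (F := F) s m₀ adv ω r u).1
    have h' : received (id u) = honest u v := by
      simp only [received, inbox]
      rw [hid.extend_apply, delivered, if_neg hF]
    have h'' : honest u v = if G.Adj u v then (floodState G id s m₀ F adv ω r u).val
        (activeColour q (floodState G id s m₀ F adv ω r u).round) else none := rfl
    rw [h', h'', h]
  · intro w hw
    exact Function.extend_apply' _ _ _ fun ⟨u, hu⟩ => hw u hu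

variable {ω} in
lemma floodState_val_eq {i : Fin (2 ^ q)} (hid : Function.Injective id)
    (hi : CleanColour id F ω i) {r : ℕ} {v : V} {m : Bits msgLen}
    (h : (floodState G id s m₀ F adv ω r v).val i = some m) : m = m₀ := by
  induction r generalizing v m with
  | zero =>
    change (if v = s then some m₀ else none) = some m at h
    split_ifs at h
    exact (Option.some.inj h).symm
  | succ r ih =>
    obtain ⟨received, h1, h2, h3⟩ := floodState_succ (G := G) s m₀ adv hid hi r v
    rw [h1] at h
    split_ifs at h with hc
    · obtain ⟨w, hw, hm⟩ := accepted_eq_some h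
      by_cases hex : ∃ u, id u = w
      · obtain ⟨u, rfl⟩ := hex
        rw [h2 u hw] at hm
        split_ifs at hm
        rw [← hc.1] at hm
        exact ih hm
      · rw [h3 w fun u hu => hex ⟨u, hu⟩] at hm
        cases hm
    · exact ih h

variable {ω} in
lemma floodState_val_mono {i : Fin (2 ^ q)} (hid : Function.Injective id)
    (hi : CleanColour id F ω i) {r k : ℕ} {v : V} (hrk : r ≤ k)
    (h : (floodState G id s m₀ F adv ω r v).val i = some m₀) :
    (floodState G id s m₀ F adv ω k v).val i = some m₀ := by
  induction k, hrk using Nat.le_induction with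
  | base => exact h
  | succ k _ ih =>
    obtain ⟨received, h1, -⟩ := floodState_succ (G := G) s m₀ adv hid hi k v
    rw [h1, if_neg (by simp [ih]), ih]

variable {ω} in
lemma floodState_val_spread {i : Fin (2 ^ q)} (hid : Function.Injective id)
    (hi : CleanColour id F ω i) {r : ℕ} (hr : i = activeColour q r) {u v : V} (huv : G.Adj u v)
    (hc : coinEquiv idLen q (ω v) (id u) = i)
    (h : (floodState G id s m₀ F adv ω r u).val i = some m₀) :
    (floodState G id s m₀ F adv ω (r + 1) v).val i = some m₀ := by
  suffices ∃ m, (floodState G id s m₀ F adv ω (r + 1) v).val i = some m by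
    obtain ⟨m, hm⟩ := this
    rw [hm, floodState_val_eq s m₀ adv hid hi hm]
  obtain ⟨received, h1, h2, -⟩ := floodState_succ (G := G) s m₀ adv hid hi r v
  rw [h1]
  split_ifs with h0
  · refine accepted_isSome hc (m := m₀) ?_
    rw [h2 u hc, if_pos huv, ← hr, h]
  · exact Option.ne_none_iff_exists'.mp fun hn => h0 ⟨hr, hn⟩

variable {ω} in
lemma floodState_val_of_clean {i : Fin (2 ^ q)} (hid : Function.Injective id)
    (hi : CleanColour id F ω i) {φ : ℝ} (hφ : 0 < φ) (hG : IsExpander G φ)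
    (hd : 0 < G.minDegree) {E : ℕ} (hE : 16 * Real.log (Fintype.card V) / φ < E)
    (hs : Spreading G fun u v => coinEquiv idLen q (ω v) (id u) = i) (v : V) :
    (floodState G id s m₀ F adv ω (2 ^ q * (2 * E)) v).val i = some m₀ := by
  let S : ℕ → Finset V := fun j =>
    Finset.univ.filter fun v => (floodState G id s m₀ F adv ω (2 ^ q * j) v).val i = some m₀
  have hi_lt := i.isLt
  have huniv : S (2 * E) = Finset.univ := by
    refine hs.eq_univ hφ hG hd ⟨s, ?_⟩ ?_ ?_ hE
    · simp only [S, Finset.mem_filter, Finset.mem_univ, true_and]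
      refine floodState_val_mono s m₀ adv hid hi (Nat.zero_le _) ?_
      change (if s = s then some m₀ else none) = some m₀
      rw [if_pos rfl]
    · intro j v hv
      simp only [S, Finset.mem_filter, Finset.mem_univ, true_and] at hv ⊢
      exact floodState_val_mono s m₀ adv hid hi (Nat.mul_le_mul_left _ (Nat.le_succ j)) hv
    · intro j u hu v huv hc
      simp only [S, Finset.mem_filter, Finset.mem_univ, true_and] at hu ⊢
      -- A phase is `2 ^ q` rounds and contains exactly one round of colour `i`, at offset `i`.
      have hact : i = activeColour q (2 ^ q * j + i) := by
        ext
        simp [activeColour, Nat.mod_eq_of_lt hi_lt]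
      refine floodState_val_mono s m₀ adv hid hi (r := 2 ^ q * j + i + 1) ?_ ?_
      · rw [Nat.mul_succ]; omega
      · exact floodState_val_spread s m₀ adv hid hi hact huv hc
          (floodState_val_mono s m₀ adv hid hi (Nat.le_add_right _ _) hu)
  have hv := Finset.mem_univ v
  rw [← huniv] at hv
  exact (Finset.mem_filter.mp hv).2

variable {ω} in
lemma broadcastSucceeds_of_spreading {E : ℕ}
    (adv : Strategy V (floodAlgorithm idLen msgLen q (2 ^ q * (2 * E))).coinLen msgLen)
    (hid : Function.Injective id) {φ : ℝ} (hφ : 0 < φ)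
    (hG : IsExpander G φ) (hd : 0 < G.minDegree)
    (hE : 16 * Real.log (Fintype.card V) / φ < E) (hF : 4 * F.card < 2 ^ q)
    (hs : ∀ i, Spreading G fun u v => coinEquiv idLen q (ω v) (id u) = i) :
    BroadcastSucceeds G id (floodAlgorithm idLen msgLen q (2 ^ q * (2 * E))) s m₀ F adv ω := by
  classical
  intro v
  refine majority_eq_some ?_
  have hsub : (Finset.univ.filter fun i => CleanColour id F ω i) ⊆ Finset.univ.filter fun i =>
      (floodState G id s m₀ F adv ω (2 ^ q * (2 * E)) v).val i = some m₀ := by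
    intro i hi
    have hi := (Finset.mem_filter.mp hi).2
    exact Finset.mem_filter.mpr ⟨Finset.mem_univ _,
      floodState_val_of_clean s m₀ adv hid hi hφ hG hd hE (hs i) v⟩
  have h1 := Finset.card_le_card hsub
  have h2 := card_not_cleanColour_le id F ω
  have h3 := Finset.card_filter_add_card_filter_not (s := (Finset.univ : Finset (Fin (2 ^ q))))
    (fun i => CleanColour id F ω i)
  rw [Finset.card_univ, Fintype.card_fin] at h3
  have h4 : 2 ^ q < 2 * (Finset.univ.filter fun i =>
      (floodState G id s m₀ F adv ω (2 ^ q * (2 * E)) v).val i = some m₀).card := by omega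
  convert h4
  rfl

/-- `coinEquiv` is a bijection, so uniform coins give uniform colourings, and the counting bound
applies with `γ = (c + 6) * log n`. -/
lemma one_sub_le_successProb {E : ℕ}
    (adv : Strategy V (floodAlgorithm idLen msgLen q (2 ^ q * (2 * E))).coinLen msgLen)
    (hid : Function.Injective id) {φ : ℝ} (hφ : 0 < φ) (hG : IsExpander G φ)
    (hd : 0 < G.minDegree) (hE : 16 * Real.log (Fintype.card V) / φ < E)
    (hF : 4 * F.card < 2 ^ q) {c : ℕ} (hV : 2 ≤ Fintype.card V)
    (hdeg : 5 * ((c + 6 : ℕ) * Real.log (Fintype.card V)) * (2 ^ q : ℕ) ≤ φ * G.minDegree)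
    (hq : 2 ^ q ≤ Fintype.card V) :
    1 - 1 / (Fintype.card V : ℝ) ^ c ≤
      successProb G id (floodAlgorithm idLen msgLen q (2 ^ q * (2 * E))) s m₀ F adv := by
  classical
  let Ω := V → Bits (2 ^ idLen * q)
  let bad : Finset Ω := Finset.univ.filter fun ω =>
    ∃ i, ¬ Spreading G fun u v => coinEquiv idLen q (ω v) (id u) = i
  let e : Ω ≃ (V → Bits idLen → Fin (2 ^ q)) := Equiv.piCongrRight fun _ => coinEquiv idLen q
  have hbad : (bad.card : ℝ) ≤ 1 / (Fintype.card V : ℝ) ^ c * Fintype.card Ω := by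
    have h1 : bad.card = (Finset.univ.filter fun ω : V → Bits idLen → Fin (2 ^ q) =>
        ∃ i, ¬ Spreading G fun u v => ω v (id u) = i).card :=
      Finset.card_equiv e fun ω => by
        simp only [bad, Finset.mem_filter, Finset.mem_univ, true_and]
        rfl
    rw [h1, Fintype.card_congr e]
    refine (card_not_spreading_le hid hφ (hG.le_one hd s) hG hd hdeg rfl).trans ?_
    gcongr
    exact union_bound_le hV (by exact_mod_cast hq) rfl
  have hsucc : (↑badᶜ : Set Ω) ⊆ {ω | BroadcastSucceeds G id
      (floodAlgorithm idLen msgLen q (2 ^ q * (2 * E))) s m₀ F adv ω} := by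
    intro ω hω
    have hω' : ∀ i, Spreading G fun u v => coinEquiv idLen q (ω v) (id u) = i := by
      simpa [bad] using hω
    exact broadcastSucceeds_of_spreading s m₀ adv hid hφ hG hd hE hF hω'
  have hΩ : (0 : ℝ) < Fintype.card Ω := by exact_mod_cast Fintype.card_pos
  have hprob : (ProbabilityTheory.uniformOn (Set.univ : Set Ω)).real (↑badᶜ : Set Ω)
      = (Fintype.card Ω - bad.card) / Fintype.card Ω := by
    rw [MeasureTheory.measureReal_def, ProbabilityTheory.uniformOn_univ,
      MeasureTheory.Measure.count_apply_finset, Finset.card_compl, ENNReal.toReal_div,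
      ENNReal.toReal_natCast, ENNReal.toReal_natCast, Nat.cast_sub (Finset.card_le_univ bad)]
  calc 1 - 1 / (Fintype.card V : ℝ) ^ c
      ≤ (Fintype.card Ω - bad.card) / Fintype.card Ω := by
        rw [le_div_iff₀ hΩ]; linarith
    _ = _ := hprob.symm
    _ ≤ _ := MeasureTheory.measureReal_mono hsucc

end Flood

end AdvCongest

/-! ### Choice of parameters -/

namespace AdvCongest

lemma two_pow_clog_le {t : ℕ} (ht : 1 ≤ t) : 2 ^ Nat.clog 2 (4 * t + 1) ≤ 8 * t := by
  have h1 := Nat.pow_pred_clog_lt_self (b := 2) (x := 4 * t + 1) (by norm_num) (by omega)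
  have h2 : 0 < Nat.clog 2 (4 * t + 1) := Nat.clog_pos (by norm_num) (by omega)
  obtain ⟨k, hk⟩ := Nat.exists_eq_succ_of_ne_zero h2.ne'
  rw [hk] at h1 ⊢
  rw [Nat.pred_succ] at h1
  rw [pow_succ]
  omega

end AdvCongest

open AdvCongest in
/-- Constants: `a` for the polynomial estimate of `n` and the `O(log n)` length of identifiers and
of the broadcast message, `b` for the linear estimate of `φ`, `c` for "with high probability".
The nodes know `N`, `t` and `ψ` (estimates of `n` and `φ`, and the bound on the number of
adversarial edges), but not the graph. -/
theorem theorem3 (a : ℕ) (b : ℝ) (c : ℕ) (ha : 1 ≤ a) (hb : 1 ≤ b) :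
    ∃ (C K : ℝ) (B : ℕ)
      (alg : (N t : ℕ) → (ψ : ℝ) →
        Algorithm (a * Nat.clog 2 N) (a * Nat.clog 2 N) (B * Nat.clog 2 N)),
      0 < C ∧ 0 < K ∧
      ∀ (n t N : ℕ) (φ ψ : ℝ) (G : SimpleGraph (Fin n)) [DecidableRel G.Adj],
        2 ≤ n → 1 ≤ t → 0 < φ →
        IsExpander G φ →
        C * ((t : ℝ) ^ 2 * Real.log n / φ) ≤ (G.minDegree : ℝ) →
        n ≤ N ^ a → N ≤ n ^ a →
        φ ≤ b * ψ → ψ ≤ b * φ →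
        ((alg N t ψ).rounds : ℝ) ≤ K * (t * Real.log n ^ 2 / φ) ∧
        ∀ (id : Fin n → Bits (a * Nat.clog 2 N)), Function.Injective id →
        ∀ (s : Fin n) (m₀ : Bits (a * Nat.clog 2 N)) (F : Finset (Sym2 (Fin n))),
          F ⊆ G.edgeFinset → F.card ≤ t →
        ∀ adv : Strategy (Fin n) (alg N t ψ).coinLen (B * Nat.clog 2 N),
          1 - 1 / (n : ℝ) ^ c ≤ successProb G id (alg N t ψ) s m₀ F adv := by
  -- `40 = 5 * 8` combines the 5 of `card_blocking_le` with `2 ^ q ≤ 8 * t`. The factor `a * b` in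
  -- the phase count covers the errors in `log n ≤ a * log N` and `1 / φ ≤ b / ψ`.
  refine ⟨40 * (c + 6 : ℕ), 32 * (16 * a ^ 2 * b ^ 2 + 2), a,
    fun N t ψ => floodAlgorithm (a * Nat.clog 2 N) (a * Nat.clog 2 N) (Nat.clog 2 (4 * t + 1))
      (2 ^ Nat.clog 2 (4 * t + 1) * (2 * (⌊16 * (a * b) * Real.log N / ψ⌋₊ + 1))),
    by positivity, by positivity, ?_⟩
  intro n t N φ ψ G _ hn ht hφ hG hdeg hnN hNn hφψ hψφ
  have hψ : 0 < ψ := by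
    by_contra! h
    nlinarith
  have hn' : (2 : ℝ) ≤ n := by exact_mod_cast hn
  have ht' : (1 : ℝ) ≤ t := by exact_mod_cast ht
  have ha' : (1 : ℝ) ≤ a := by exact_mod_cast ha
  have hlog : 1 / 2 < Real.log n := by
    have := Real.log_le_log (by norm_num) hn'
    linarith [Real.log_two_gt_d9]
  have hN : 0 < N := by
    by_contra h
    rw [Nat.eq_zero_of_not_pos h, zero_pow (by omega)] at hnN
    omega
  have hlogN : Real.log n ≤ a * Real.log N := by
    rw [← Real.log_pow]
    exact Real.log_le_log (by linarith) (by exact_mod_cast hnN)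
  have hlogN' : Real.log N ≤ a * Real.log n := by
    rw [← Real.log_pow]
    exact Real.log_le_log (by exact_mod_cast hN) (by exact_mod_cast hNn)
  have hlogN0 : 0 ≤ Real.log N := Real.log_natCast_nonneg N
  have hd : 0 < G.minDegree := by
    have : (0 : ℝ) < G.minDegree := lt_of_lt_of_le (by positivity) hdeg
    exact_mod_cast this
  have hφ1 : φ ≤ 1 := hG.le_one hd ⟨0, by omega⟩
  set q := Nat.clog 2 (4 * t + 1) with hq
  set E := ⌊16 * (a * b) * Real.log N / ψ⌋₊ + 1 with hEdef
  have hQ : ((2 ^ q : ℕ) : ℝ) ≤ 8 * t := by exact_mod_cast two_pow_clog_le ht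
  have hψinv : 1 / φ ≤ b / ψ := by
    rw [div_le_div_iff₀ hφ hψ]; linarith
  have hφinv : 1 / ψ ≤ b / φ := by
    rw [div_le_div_iff₀ hψ hφ]; linarith
  constructor
  · change ((2 ^ q * (2 * E) : ℕ) : ℝ) ≤ _
    have hfloor : (E : ℝ) ≤ 16 * (a * b) * Real.log N / ψ + 1 := by
      rw [hEdef]; push_cast
      gcongr
      exact Nat.floor_le (by positivity)
    have h1 : 16 * (a * b) * Real.log N / ψ ≤ 16 * a ^ 2 * b ^ 2 * (Real.log n / φ) :=
      calc 16 * (a * b) * Real.log N / ψ = 16 * (a * b) * Real.log N * (1 / ψ) := by ring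
        _ ≤ 16 * (a * b) * (a * Real.log n) * (b / φ) := by gcongr
        _ = _ := by ring
    have h2 : 1 ≤ 2 * (Real.log n / φ) := by
      rw [← mul_div_assoc, le_div_iff₀ hφ]; linarith
    have h3 : (E : ℝ) ≤ (16 * a ^ 2 * b ^ 2 + 2) * (Real.log n / φ) := by linarith
    calc ((2 ^ q * (2 * E) : ℕ) : ℝ) = (2 ^ q : ℕ) * (2 * E) := by push_cast; ring
      _ ≤ 8 * t * (2 * ((16 * a ^ 2 * b ^ 2 + 2) * (Real.log n / φ))) := by gcongr
      -- The round count is in fact `O(t log n / φ)`; the second logarithm enters only through `1 /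
      -- 2 ≤ log n`.
      _ = 32 * (16 * a ^ 2 * b ^ 2 + 2) * (t * (Real.log n * (1 / 2)) / φ) := by ring
      _ ≤ 32 * (16 * a ^ 2 * b ^ 2 + 2) * (t * (Real.log n * Real.log n) / φ) := by gcongr
      _ = _ := by ring
  · intro id hid s m₀ F _ hFt adv
    have hE : 16 * Real.log (Fintype.card (Fin n)) / φ < E := by
      rw [Fintype.card_fin, hEdef]
      push_cast
      refine lt_of_le_of_lt ?_ (Nat.lt_floor_add_one _)
      calc 16 * Real.log n / φ = 16 * Real.log n * (1 / φ) := by ring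
        _ ≤ 16 * (a * Real.log N) * (b / ψ) := by gcongr
        _ = _ := by ring
    have hF : 4 * F.card < 2 ^ q := by
      have : 4 * t + 1 ≤ 2 ^ q := Nat.le_pow_clog (by norm_num) _
      omega
    have hdeg' : 5 * ((c + 6 : ℕ) * Real.log n) * (2 ^ q : ℕ) ≤ φ * G.minDegree :=
      calc 5 * ((c + 6 : ℕ) * Real.log n) * (2 ^ q : ℕ)
          ≤ 5 * ((c + 6 : ℕ) * Real.log n) * (8 * (t * t)) := by
            gcongr
            refine hQ.trans ?_
            gcongr
            exact le_mul_of_one_le_left (by linarith) ht'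
        _ = φ * (40 * (c + 6 : ℕ) * ((t : ℝ) ^ 2 * Real.log n / φ)) := by field_simp; ring
        _ ≤ φ * G.minDegree := by gcongr
    -- The degree condition bounds the number of colours by `φ * G.minDegree ≤ n`, so the union
    -- bound over colours costs at most a factor `n`.
    have hQn : 2 ^ q ≤ n := by
      have h1 : φ * (G.minDegree : ℝ) ≤ n := by
        have : G.minDegree ≤ n := by
          have := (G.minDegree_le_degree ⟨0, by omega⟩).trans_lt (G.degree_lt_card_verts _)
          rw [Fintype.card_fin] at this
          exact this.le
        exact (mul_le_of_le_one_left (Nat.cast_nonneg _) hφ1).trans (by exact_mod_cast this)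
      have h2 : (1 : ℝ) * (2 ^ q : ℕ) ≤ 5 * ((c + 6 : ℕ) * Real.log n) * (2 ^ q : ℕ) := by
        gcongr
        push_cast
        nlinarith [(Nat.cast_nonneg c : (0 : ℝ) ≤ c)]
      have h3 : ((2 ^ q : ℕ) : ℝ) ≤ n := by linarith
      exact_mod_cast h3
    simpa only [Fintype.card_fin] using one_sub_le_successProb s m₀ adv hid hφ hG hd hE hF
      (c := c) (by rwa [Fintype.card_fin]) (by rwa [Fintype.card_fin]) (by rwa [Fintype.card_fin])
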